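/- Let $V$ be a finite set of points (nodes) in the Euclidean plane, each carrying a distinct identifier $\mathrm{ID}(u)$, and let $G$ be the unit disk graph on $V$ (distinct $u,v$ are adjacent iff $|uv|\le 1$). The identifier of a directed edge $\overrightarrow{uv}$ is $(|uv|,\mathrm{ID}(u),\mathrm{ID}(v))$, ordered lexicographically, and $\mathrm{ID}(uv)=\min\{\mathrm{ID}(\overrightarrow{uv}),\mathrm{ID}(\overrightarrow{vu})\}$. For an integer $k$, let each node $u$ be the apex of $k$ half-open cones of angle $\theta=2\pi/k$ cut out by $k$ equally separated rays from $u$; the same cones are used throughout. The Yao-Sparse-Sink algorithm with parameters $k$ and $r>1$ is the following. 1. (Yao step) For each node $u$ and each cone $K_u$ at $u$ containing a neighbour of $u$ in $G$, take the edge $uv$ of $G$ with $v\in K_u$ of lowest identifier and put $\overrightarrow{uv}$ into $E_Y$. 2. (Filtering) For each node $v$ and each cone $K_v$, let $F$ be the set of the edges $\overrightarrow{uv}\in E_Y$ with $u\in K_v$, and, if $F\neq\emptyset$, let $m$ be the length of the edge of minimum identifier in $F$. Partition $F$ into the classes $F_i=\{ab\in F : m r^{i-1}\le |ab|<m r^{i}\}$,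 $i=1,2,\dots$, and put the edge of smallest identifier of each nonempty class into $E_{YE}$. 3. (Sink step) For each node $v$ and each cone $K_v$, let $I=I(v)$ be the set of all $u\in K_v$ with $\overrightarrow{uv}\in E_{YE}$, let $J=(v)$ and $T(v)=\emptyset$, and repeat until $I$ is empty: remove the first node $u$ from the queue $J$; for each cone $K_u$ with $I(u)\cap K_u\ne\emptyset$, let $w\in I(u)\cap K_u$ minimize $\mathrm{ID}(\overrightarrow{wu})$, add $\overrightarrow{wu}$ to $T(v)$, move $w$ from $I$ to the end of $J$, and set $I(w)=I(u)\cap K_u$. (A cone does not contain its apex.) The output $YES_k$ is the union of all the trees $T(v)$, viewed as an undirected graph on $V$. Theorem. Let $r>1$, let $k\ge 8$ be an integer, and let $\theta=2\pi/k$ and $\lambda=\frac{1}{2r\cos\theta}$ be such that $\cos\theta-\sin\theta>\frac{1}{\lambda+1}$. Then the output $YES_k$ of the Yao-Sparse-Sink algorithm on $G$ has maximum degree at most $k(k+2)$, and for every $$t\ \ge\ \frac{\lambda/\cos 2\theta}{(\lambda+1)(\cos\theta-\sin\theta)-1}$$ it is a length $t$-spanner of $G$: it is a subgraph of $G$, and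 for all $u,v\in V$ that are connected in $G$ the length of a shortest $uv$-path in $YES_k$ is at most $t$ times the length of a shortest $uv$-path in $G$. -/

import Mathlib

/-- The Euclidean plane. -/
abbrev Plane : Type := EuclideanSpace ℝ (Fin 2)

/-- The unit disk graph of nodes placed at `pos`: two distinct nodes are adjacent iff their
Euclidean distance is at most `1`. -/
def unitDiskGraph {V : Type*} (pos : V → Plane) : SimpleGraph V where
  Adj u v := u ≠ v ∧ dist (pos u) (pos v) ≤ 1
  symm := ⟨fun _ _ h => ⟨h.1.symm, by rw [dist_comm]; exact h.2⟩⟩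
  loopless := ⟨fun _ h => h.1 rfl⟩

/-- The Euclidean length of a walk. -/
noncomputable def walkLength {V : Type*} (pos : V → Plane) {G : SimpleGraph V} {u v : V}
    (p : G.Walk u v) : ℝ :=
  (p.darts.map fun d => dist (pos d.fst) (pos d.snd)).sum

/-- `H` is a length `t`-spanner of `G`: it is a subgraph of `G`, and for every pair of vertices
a shortest path in `H` is at most `t` times as long as a shortest path in `G`, i.e. every walk
of `G` is matched by a walk of `H` with the same ends that is at most `t` times as long. -/
def IsLengthSpanner {V : Type*} (pos : V → Plane) (G H : SimpleGraph V) (t : ℝ) : Prop :=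
  H ≤ G ∧ ∀ (u v : V) (p : G.Walk u v), ∃ q : H.Walk u v, walkLength pos q ≤ t * walkLength pos p

/-- The identifier `(|uv|, ID u, ID v)` of the directed edge from `u` to `v`, compared
lexicographically. -/
noncomputable def dirID {V : Type*} (pos : V → Plane) (ID : V → ℕ) (u v : V) : ℝ ×ₗ (ℕ ×ₗ ℕ) :=
  toLex (dist (pos u) (pos v), toLex (ID u, ID v))

/-- The identifier of the undirected edge `uv`. -/
noncomputable def edgeID {V : Type*} (pos : V → Plane) (ID : V → ℕ) (u v : V) : ℝ ×ₗ (ℕ ×ₗ ℕ) :=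
  min (dirID pos ID u v) (dirID pos ID v u)

/-- The `j`-th of the `k` half-open cones with apex `p` and angle `2π/k` that are cut out by `k`
equally separated rays from `p`, the ray number `0` having direction angle `a`.
The apex is not in any of them. -/
def cone (k : ℕ) (p : Plane) (a : ℝ) (j : Fin k) : Set Plane :=
  {x | ∃ ρ > (0 : ℝ), ∃ φ ∈ Set.Ico (a + j * (2 * Real.pi / k)) (a + (j + 1) * (2 * Real.pi / k)),
    x = p + ρ • !₂[Real.cos φ, Real.sin φ]}

/-- The nodes of `S` that lie in the `j`-th cone of the node `u`, where `ray u` is the direction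
angle of the first ray at `u`. -/
def inCone {V : Type*} (pos : V → Plane) (ray : V → ℝ) (k : ℕ) (u : V) (j : Fin k) (S : Set V) :
    Set V :=
  {w ∈ S | pos w ∈ cone k (pos u) (ray u) j}

/-- The Yao step: `yaoStep pos ID ray k G u v` says that the directed edge from `u` to `v` is
chosen, i.e. that `uv` has the lowest identifier among the edges of `G` at `u` in some cone
of `u`. -/
def yaoStep {V : Type*} (pos : V → Plane) (ID : V → ℕ) (ray : V → ℝ) (k : ℕ) (G : SimpleGraph V)
    (u v : V) : Prop :=
  ∃ j : Fin k, v ∈ inCone pos ray k u j (G.neighborSet u) ∧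
    ∀ w ∈ inCone pos ray k u j (G.neighborSet u), edgeID pos ID u v ≤ edgeID pos ID u w

/-- The sources of the directed edges of `E` into `v` that lie in the `j`-th cone of `v`. -/
def inStar {V : Type*} (pos : V → Plane) (ray : V → ℝ) (k : ℕ) (E : V → V → Prop) (v : V)
    (j : Fin k) : Set V :=
  inCone pos ray k v j {u | E u v}

/-- Among the directed edges from nodes of `S` into `v`, the edge from `u` has the smallest
identifier. -/
def IsMinSource {V : Type*} (pos : V → Plane) (ID : V → ℕ) (v : V) (S : Set V) (u : V) : Prop :=
  u ∈ S ∧ ∀ w ∈ S, dirID pos ID u v ≤ dirID pos ID w v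

/-- The sources in `S` whose edge into `v` has length in `[m r ^ i, m r ^ (i + 1))`. -/
def lengthClass {V : Type*} (pos : V → Plane) (r m : ℝ) (v : V) (S : Set V) (i : ℕ) : Set V :=
  {u ∈ S | m * r ^ i ≤ dist (pos u) (pos v) ∧ dist (pos u) (pos v) < m * r ^ (i + 1)}

/-- The filtering step: for each node `v` and each cone of `v`, the directed edges of `E` into
`v` in that cone are partitioned into length classes, starting at the length of the edge `u₀ v`
of minimum identifier, and the edge of smallest identifier of each class is kept. -/
def sparseStep {V : Type*} (pos : V → Plane) (ID : V → ℕ) (ray : V → ℝ) (k : ℕ) (r : ℝ)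
    (E : V → V → Prop) (u v : V) : Prop :=
  ∃ (j : Fin k) (u₀ : V) (i : ℕ), IsMinSource pos ID v (inStar pos ray k E v j) u₀ ∧
    IsMinSource pos ID v
      (lengthClass pos r (dist (pos u₀) (pos v)) v (inStar pos ray k E v j) i) u

open Classical in
/-- The part of the finite set `S` in the `j`-th cone of `u`. -/
noncomputable def conePart {V : Type*} (pos : V → Plane) (ray : V → ℝ) (k : ℕ) (u : V)
    (S : Finset V) (j : Fin k) : Finset V :=
  S.filter fun w => pos w ∈ cone k (pos u) (ray u) j

open Classical in
/-- One round of the construction of a sink tree, processing a node `u` with `I(u) = S`: for each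
cone `K` of `u` for which `S ∩ K` is nonempty, the node `w ∈ S ∩ K` that minimizes the identifier
of the directed edge from `w` to `u`, together with the set `I(w) = S ∩ K`. -/
noncomputable def sinkChildren {V : Type*} (pos : V → Plane) (ID : V → ℕ) (ray : V → ℝ) (k : ℕ)
    (u : V) (S : Finset V) : List (V × Finset V) :=
  (List.finRange k).filterMap fun j =>
    ((conePart pos ray k u S j).toList.argmin fun w => dirID pos ID w u).map
      fun w => (w, conePart pos ray k u S j)

open Classical in
/-- The main loop of the construction of a sink tree. `I` is the set of nodes still to be
attached, `J` is the queue of the nodes `u` still to be processed, each paired with its set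
`I(u)`, and `T` is the set of directed edges added so far. Until `I` is empty, the first node
`u` of the queue is removed, its children `w` are found, the edges from `w` to `u` are added, and
the nodes `w` are moved from `I` to the end of the queue. -/
noncomputable def sinkLoop {V : Type*} (pos : V → Plane) (ID : V → ℕ) (ray : V → ℝ) (k : ℕ)
    (I : Finset V) (J : List (V × Finset V)) (T : Finset (V × V)) : Finset (V × V) :=
  if I = ∅ then T else
  match J with
  | [] => T
  | (u, S) :: J' =>
    sinkLoop pos ID ray k
      (I \ ((sinkChildren pos ID ray k u S).map Prod.fst).toFinset)
      (J' ++ (sinkChildren pos ID ray k u S).filter fun c => c.1 ∈ I)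
      (T ∪ ((sinkChildren pos ID ray k u S).map fun c => (c.1, u)).toFinset)
termination_by (I.card, J.length)
decreasing_by
  rcases hC : (sinkChildren pos ID ray k u S).filter (fun c => decide (c.1 ∈ I)) with _ | ⟨c, C⟩
  · have hl : (J' ++ (sinkChildren pos ID ray k u S).filter
        (fun c => decide (c.1 ∈ I))).length < ((u, S) :: J').length := by
      rw [hC, List.append_nil]
      exact Nat.lt_succ_self _
    have h : (I \ ((sinkChildren pos ID ray k u S).map Prod.fst).toFinset).card ≤ I.card :=
      Finset.card_le_card Finset.sdiff_subset
    rcases h.lt_or_eq with h | h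
    · exact Prod.Lex.left _ _ h
    · rw [h]
      exact Prod.Lex.right _ hl
  · apply Prod.Lex.left
    have hc : c ∈ (sinkChildren pos ID ray k u S).filter (fun c => decide (c.1 ∈ I)) := by
      rw [hC]; exact List.mem_cons_self
    rw [List.mem_filter, decide_eq_true_iff] at hc
    apply Finset.card_lt_card
    refine Finset.ssubset_iff_of_subset Finset.sdiff_subset |>.2 ⟨c.1, hc.2, fun h => ?_⟩
    exact (Finset.mem_sdiff.1 h).2
      (List.mem_toFinset.2 (List.mem_map.2 ⟨c, hc.1, rfl⟩))

open Classical in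
/-- The sink tree `T(v)` for the node `v` and its `j`-th cone: initially `I = I(v)` is the set of
sources of the edges of `E` into `v` in this cone, and the queue is `J = (v)`. -/
noncomputable def sinkTree {V : Type*} [Fintype V] (pos : V → Plane) (ID : V → ℕ) (ray : V → ℝ)
    (k : ℕ) (E : V → V → Prop) (v : V) (j : Fin k) : Finset (V × V) :=
  sinkLoop pos ID ray k (Finset.univ.filter fun u => u ∈ inStar pos ray k E v j)
    [(v, Finset.univ.filter fun u => u ∈ inStar pos ray k E v j)] ∅

/-- The sink step: the union of the sink trees of all nodes and all cones. -/
def sinkStep {V : Type*} [Fintype V] (pos : V → Plane) (ID : V → ℕ) (ray : V → ℝ) (k : ℕ)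
    (E : V → V → Prop) (a b : V) : Prop :=
  ∃ (v : V) (j : Fin k), (a, b) ∈ sinkTree pos ID ray k E v j

/-- The output, viewed as an undirected graph, of the Yao-Sparse-Sink algorithm with parameters
`k` and `r` on the graph `G`. -/
def yaoSparseSink {V : Type*} [Fintype V] (pos : V → Plane) (ID : V → ℕ) (ray : V → ℝ) (k : ℕ)
    (r : ℝ) (G : SimpleGraph V) : SimpleGraph V :=
  SimpleGraph.fromRel
    (sinkStep pos ID ray k (sparseStep pos ID ray k r (yaoStep pos ID ray k G)))

/-! Put a = cos θ − sin θ. Everything metric rests on one estimate (`dist_le_of_mem_cone`): if x and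
y share a cone at p and |xp| ≤ |yp|, then |xy| ≤ |yp| − a|xp|.

Sink trees: when x passes from waiting at u to waiting at the child c of u in its cone, the estimate
shortens its remaining distance by at least a|cu|. These gains telescope, so the tree path from x to
v has length at most |xv|/a, and every tree edge xy satisfies |xy| ≤ |xv| ≤ 1.

Stretch: induct on |uv|. Let uw be the Yao edge in the cone of v, and xw the kept edge in the cone
of u at w, so |xw| ≤ |uw| ≤ r|xw|. Joining inductive paths for ux and wv with the tree path for xw
costs at most t(|uw| − a|xw|) + |xw|/a + t(|uv| − a|uw|), which is at most t|uv| once 1 ≤ a t (a −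
r(1−a)). The stated bound on t implies this (`stretch_inequality`).

Degree: x has at most one child in each of its k own trees. Any other tree containing x is
determined by a Yao edge out of x, so there are at most k of these, each contributing one parent and
at most k children: k + k(k+1) = k(k+2). -/

/-! ### Geometry of cones -/

theorem dist_polar_sq (p : Plane) (ρ σ φ ψ : ℝ) :
    dist (p + ρ • !₂[Real.cos φ, Real.sin φ] : Plane) (p + σ • !₂[Real.cos ψ, Real.sin ψ]) ^ 2 =
      ρ ^ 2 + σ ^ 2 - 2 * ρ * σ * Real.cos (φ - ψ) := by
  rw [EuclideanSpace.dist_eq, Real.sq_sqrt (by positivity), Real.cos_sub]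
  simp only [Fin.sum_univ_two, Real.dist_eq, sq_abs]
  simp
  linear_combination ρ ^ 2 * Real.sin_sq_add_cos_sq φ + σ ^ 2 * Real.sin_sq_add_cos_sq ψ

theorem dist_polar_apex (p : Plane) {ρ : ℝ} (hρ : 0 < ρ) (φ : ℝ) :
    dist (p + ρ • !₂[Real.cos φ, Real.sin φ] : Plane) p = ρ := by
  have h := dist_polar_sq p ρ 0 φ 0
  simp only [zero_smul, add_zero] at h
  refine (sq_eq_sq₀ dist_nonneg hρ.le).1 ?_
  rw [h]; ring

theorem not_apex_mem_cone (k : ℕ) (p : Plane) (a : ℝ) (j : Fin k) : p ∉ cone k p a j := by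
  rintro ⟨ρ, hρ, φ, -, h⟩
  have := dist_polar_apex p hρ φ
  rw [← h, dist_self] at this
  exact hρ.ne this

theorem cone_disjoint {k : ℕ} {p : Plane} {a : ℝ} {i j : Fin k} {x : Plane}
    (hi : x ∈ cone k p a i) (hj : x ∈ cone k p a j) : i = j := by
  obtain ⟨ρ, hρ, φ, hφ, rfl⟩ := hi
  obtain ⟨σ, hσ, ψ, hψ, h⟩ := hj
  have hρσ : ρ = σ := by
    rw [← dist_polar_apex p hρ φ, h, dist_polar_apex p hσ ψ]
  subst hρσ
  have h0 := dist_polar_sq p ρ ρ φ ψ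
  rw [h, dist_self] at h0
  have hcos : Real.cos (φ - ψ) = 1 := by
    have : ρ ^ 2 * (Real.cos (φ - ψ) - 1) = 0 := by linarith
    rcases mul_eq_zero.1 this with h | h
    · exact absurd h (by positivity)
    · linarith
  have hk : (0 : ℝ) < k := by exact_mod_cast i.pos
  have hw : 0 < 2 * Real.pi / k := by positivity
  have hkw : k * (2 * Real.pi / k) = 2 * Real.pi := by field_simp
  have bound : ∀ l : Fin k, ∀ χ ∈ Set.Ico (a + l * (2 * Real.pi / k))
      (a + (l + 1) * (2 * Real.pi / k)), a ≤ χ ∧ χ < a + 2 * Real.pi := by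
    intro l χ hχ
    have h1 : (l : ℝ) + 1 ≤ k := by exact_mod_cast l.2
    have h2 := mul_le_mul_of_nonneg_right h1 hw.le
    have h3 : (0 : ℝ) ≤ l * (2 * Real.pi / k) := by positivity
    exact ⟨by linarith [hχ.1], by linarith [hχ.2]⟩
  have b1 := bound i φ hφ
  have b2 := bound j ψ hψ
  -- Both angles lie in the window [a, a + 2π), so cosine 1 leaves no other multiple of 2π.
  have he : φ - ψ = 0 :=
    (Real.cos_eq_one_iff_of_lt_of_lt (by linarith) (by linarith)).1 hcos
  have he : φ = ψ := sub_eq_zero.1 he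
  subst he
  have key : ∀ l m : Fin k, a + l * (2 * Real.pi / k) ≤ φ →
      φ < a + (m + 1) * (2 * Real.pi / k) → (l : ℕ) ≤ m := by
    intro l m h1 h2
    have h3 : (l : ℝ) < m + 1 := by
      by_contra! h
      have := mul_le_mul_of_nonneg_right h hw.le
      linarith
    have : (l : ℕ) < m + 1 := by exact_mod_cast h3
    omega
  exact Fin.ext (le_antisymm (key i j hφ.1 hψ.2) (key j i hψ.1 hφ.2))

theorem exists_polar (p x : Plane) (h : x ≠ p) :
    ∃ ρ > (0 : ℝ), ∃ φ : ℝ, x = p + ρ • !₂[Real.cos φ, Real.sin φ] := by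
  set z : ℂ := ⟨(x - p) 0, (x - p) 1⟩ with hz
  have hz0 : z ≠ 0 := by
    intro h0
    apply h
    have h1 := congrArg Complex.re h0
    have h2 := congrArg Complex.im h0
    simp only [hz, Complex.zero_re, Complex.zero_im] at h1 h2
    refine sub_eq_zero.1 ?_
    ext l
    fin_cases l
    · exact h1
    · exact h2
  refine ⟨‖z‖, norm_pos_iff.2 hz0, z.arg, ?_⟩
  rw [← sub_eq_iff_eq_add']
  ext l
  fin_cases l
  · simp [hz]
  · simp [hz]

theorem exists_mem_cone {k : ℕ} (hk : 0 < k) {p x : Plane} (a : ℝ) (h : x ≠ p) :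
    ∃ j : Fin k, x ∈ cone k p a j := by
  obtain ⟨ρ, hρ, φ, rfl⟩ := exists_polar p x h
  have hk' : (0 : ℝ) < k := by exact_mod_cast hk
  have hw : 0 < 2 * Real.pi / k := by positivity
  have hkw : k * (2 * Real.pi / k) = 2 * Real.pi := by field_simp
  set ψ := toIcoMod Real.two_pi_pos a φ with hψ
  have hmem : ψ ∈ Set.Ico a (a + 2 * Real.pi) := toIcoMod_mem_Ico _ _ _
  have hφ : ψ = φ - toIcoDiv Real.two_pi_pos a φ * (2 * Real.pi) := by
    rw [hψ, toIcoMod, zsmul_eq_mul]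
  have hq : 0 ≤ (ψ - a) / (2 * Real.pi / k) := div_nonneg (by linarith [hmem.1]) hw.le
  have hlt : (ψ - a) / (2 * Real.pi / k) < k := by
    rw [div_lt_iff₀ hw]; linarith [hmem.2]
  refine ⟨⟨⌊(ψ - a) / (2 * Real.pi / k)⌋₊, (Nat.floor_lt hq).2 hlt⟩, ρ, hρ, ψ, ⟨?_, ?_⟩, ?_⟩
  · have := (le_div_iff₀ hw).1 (Nat.floor_le hq)
    simp only
    linarith
  · have := (div_lt_iff₀ hw).1 (Nat.lt_floor_add_one ((ψ - a) / (2 * Real.pi / k)))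
    simp only
    linarith
  · rw [hφ, Real.cos_sub_int_mul_two_pi, Real.sin_sub_int_mul_two_pi]

/-- The law of cosines, with the angle at p at most θ. The saving cos θ − sin θ per unit of |xp|
drives both the sink tree bound and the spanner induction. -/
theorem dist_le_of_mem_cone {k : ℕ} {p x y : Plane} {a θ : ℝ} {j : Fin k}
    (hθ : θ = 2 * Real.pi / k) (hθπ : θ ≤ Real.pi) (hs : 0 ≤ Real.sin θ)
    (hx : x ∈ cone k p a j) (hy : y ∈ cone k p a j) (hxy : dist x p ≤ dist y p) :
    dist y x ≤ dist y p - (Real.cos θ - Real.sin θ) * dist x p := by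
  obtain ⟨ρ, hρ, φ, hφ, rfl⟩ := hx
  obtain ⟨σ, hσ, ψ, hψ, rfl⟩ := hy
  rw [dist_polar_apex p hρ, dist_polar_apex p hσ] at *
  rw [← hθ] at hφ hψ
  have hδ : |ψ - φ| ≤ θ := by
    rw [abs_le]
    constructor <;> linarith [hφ.1, hφ.2, hψ.1, hψ.2]
  have hcos : Real.cos θ ≤ Real.cos (ψ - φ) := by
    rw [← Real.cos_abs (ψ - φ)]
    exact Real.cos_le_cos_of_nonneg_of_le_pi (abs_nonneg _) hθπ hδ
  have hc1 := Real.cos_le_one θ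
  have hsc := Real.sin_sq_add_cos_sq θ
  set c := Real.cos θ
  set s := Real.sin θ
  have h0 : 0 ≤ σ - (c - s) * ρ := by nlinarith
  -- As (c − s)² = 1 − 2cs, the squared claim follows from 2csρ² ≤ 2sρσ, which uses c ≤ 1 and ρ ≤ σ.
  refine (sq_le_sq₀ dist_nonneg h0).1 ?_
  rw [dist_polar_sq]
  have h1 : σ * ρ * c ≤ σ * ρ * Real.cos (ψ - φ) := mul_le_mul_of_nonneg_left hcos (by positivity)
  have h2 : c * s * ρ ^ 2 ≤ s * ρ ^ 2 := by
    have : 0 ≤ s * ρ ^ 2 := by positivity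
    nlinarith
  have h3 : s * ρ ^ 2 ≤ s * (σ * ρ) := by
    apply mul_le_mul_of_nonneg_left _ hs
    nlinarith
  have h4 : ρ ^ 2 = (s ^ 2 + c ^ 2) * ρ ^ 2 := by rw [hsc, one_mul]
  nlinarith

/-! ### Construction of sink trees -/

open Classical in
theorem mem_conePart {V : Type*} {pos : V → Plane} {ray : V → ℝ} {k : ℕ} {u : V} {S : Finset V}
    {j : Fin k} {x : V} :
    x ∈ conePart pos ray k u S j ↔ x ∈ S ∧ pos x ∈ cone k (pos u) (ray u) j := by
  simp [conePart]

theorem dist_le_of_dirID_le {V : Type*} {pos : V → Plane} {ID : V → ℕ} {u v x y : V}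
    (h : dirID pos ID u v ≤ dirID pos ID x y) : dist (pos u) (pos v) ≤ dist (pos x) (pos y) := by
  rcases Prod.Lex.le_iff.1 h with h | h
  · exact h.le
  · exact h.1.le

theorem mem_sinkChildren {V : Type*} {pos : V → Plane} {ID : V → ℕ} {ray : V → ℝ} {k : ℕ} {u : V}
    {S : Finset V} {c : V × Finset V} :
    c ∈ sinkChildren pos ID ray k u S ↔ ∃ j : Fin k,
      c.1 ∈ (conePart pos ray k u S j).toList.argmin (fun w => dirID pos ID w u) ∧
        c.2 = conePart pos ray k u S j := by
  simp only [sinkChildren, List.mem_filterMap, List.mem_finRange, true_and, Option.map_eq_some_iff,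
    Option.mem_def]
  refine exists_congr fun j => ⟨?_, ?_⟩
  · rintro ⟨w, hw, rfl⟩
    exact ⟨hw, rfl⟩
  · rintro ⟨h1, h2⟩
    exact ⟨c.1, h1, by rw [← h2]⟩

theorem exists_cone_of_mem_sinkChildren {V : Type*} {pos : V → Plane} {ID : V → ℕ} {ray : V → ℝ}
    {k : ℕ} {u : V} {S : Finset V} {c : V × Finset V} (hc : c ∈ sinkChildren pos ID ray k u S) :
    ∃ j : Fin k, c.2 = conePart pos ray k u S j ∧ c.1 ∈ c.2 ∧
      ∀ x ∈ c.2, dist (pos c.1) (pos u) ≤ dist (pos x) (pos u) := by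
  obtain ⟨j, h1, h2⟩ := mem_sinkChildren.1 hc
  refine ⟨j, h2, ?_, fun x hx => ?_⟩
  · rw [h2]
    exact Finset.mem_toList.1 (List.argmin_mem h1)
  · rw [h2] at hx
    have h := List.not_lt_of_mem_argmin (Finset.mem_toList.2 hx) h1
    rw [not_lt] at h
    exact dist_le_of_dirID_le h

theorem exists_mem_sinkChildren {V : Type*} {pos : V → Plane} {ID : V → ℕ} {ray : V → ℝ}
    {k : ℕ} {u : V} {S : Finset V} {j : Fin k} {x : V} (hx : x ∈ conePart pos ray k u S j) :
    ∃ c ∈ sinkChildren pos ID ray k u S, c.2 = conePart pos ray k u S j := by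
  rcases h : (conePart pos ray k u S j).toList.argmin (fun w => dirID pos ID w u) with _ | w
  · rw [List.argmin_eq_none, Finset.toList_eq_nil] at h
    simp [h] at hx
  · exact ⟨(w, conePart pos ray k u S j), mem_sinkChildren.2 ⟨j, h, rfl⟩, rfl⟩

theorem sinkChildren_unique {V : Type*} {pos : V → Plane} {ID : V → ℕ} {ray : V → ℝ}
    {k : ℕ} {u : V} {S : Finset V} {c d : V × Finset V} (hc : c ∈ sinkChildren pos ID ray k u S)
    (hd : d ∈ sinkChildren pos ID ray k u S) {j : Fin k}
    (hcj : pos c.1 ∈ cone k (pos u) (ray u) j) (hdj : pos d.1 ∈ cone k (pos u) (ray u) j) :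
    c.1 = d.1 := by
  obtain ⟨i, hi, hi'⟩ := mem_sinkChildren.1 hc
  obtain ⟨l, hl, hl'⟩ := mem_sinkChildren.1 hd
  obtain rfl := cone_disjoint (mem_conePart.1 (Finset.mem_toList.1 (List.argmin_mem hi))).2 hcj
  obtain rfl := cone_disjoint (mem_conePart.1 (Finset.mem_toList.1 (List.argmin_mem hl))).2 hdj
  exact Option.some_inj.1 (hi.symm.trans hl)

/-- Different children come from different cones, and cones at one apex are disjoint. -/
theorem pairwise_sinkChildren {V : Type*} {pos : V → Plane} {ID : V → ℕ} {ray : V → ℝ}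
    {k : ℕ} {u : V} {S : Finset V} :
    (sinkChildren pos ID ray k u S).Pairwise fun c d => c.1 ≠ d.1 ∧ Disjoint c.2 d.2 := by
  rw [sinkChildren, List.pairwise_filterMap]
  refine (List.nodup_finRange k).imp fun {i j} hij c hc d hd => ?_
  obtain ⟨w, hw, rfl⟩ := Option.map_eq_some_iff.1 hc
  obtain ⟨x, hx, rfl⟩ := Option.map_eq_some_iff.1 hd
  have hdis : Disjoint (conePart pos ray k u S i) (conePart pos ray k u S j) :=
    Finset.disjoint_left.2 fun y h1 h2 =>
      hij (cone_disjoint (mem_conePart.1 h1).2 (mem_conePart.1 h2).2)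
  refine ⟨fun h => ?_, hdis⟩
  have h1 := Finset.mem_toList.1 (List.argmin_mem hw)
  have h2 := Finset.mem_toList.1 (List.argmin_mem hx)
  exact Finset.disjoint_left.1 hdis h1 ((show w = x from h) ▸ h2)

/-- The loop invariant of the construction of a sink tree with root `v` and node set `I₀`:
the edges `T` form a forest with at most one child per cone, and every node of `I₀` is either
attached to `v` or waits in the set of a queued node, `1 / a` bounding the stretch. -/
structure SinkInvariant {V : Type*} (pos : V → Plane) (ray : V → ℝ) (k : ℕ) (a : ℝ) (v : V)
    (I₀ I : Finset V) (J : List (V × Finset V)) (T : Finset (V × V)) : Prop where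
  subset : I ⊆ I₀
  waiting : ∀ p ∈ J, ∀ x ∈ p.2, x = p.1 ∨ x ∈ I
  attached : ∀ p ∈ J, p.1 ∉ I
  node : ∀ p ∈ J, p.1 = v ∨ p.1 ∈ I₀
  part : ∀ p ∈ J, p.2 ⊆ I₀
  disjoint : J.Pairwise fun p q => p.1 ≠ q.1 ∧ Disjoint p.2 q.2
  closer : ∀ p ∈ J, ∀ x ∈ p.2, dist (pos x) (pos p.1) ≤ dist (pos x) (pos v)
  source : ∀ x y, (x, y) ∈ T → x ∈ I₀ ∧ x ∉ I
  target : ∀ x y, (x, y) ∈ T → (y = v ∨ y ∈ I₀) ∧ y ∉ I ∧ ∀ p ∈ J, p.1 ≠ y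
  edge : ∀ x y, (x, y) ∈ T → x ≠ y ∧ dist (pos x) (pos y) ≤ dist (pos x) (pos v)
  parent : ∀ x y z, (x, y) ∈ T → (x, z) ∈ T → y = z
  child : ∀ x y z, (x, z) ∈ T → (y, z) ∈ T → ∀ j : Fin k, pos x ∈ cone k (pos z) (ray z) j →
    pos y ∈ cone k (pos z) (ray z) j → x = y
  reach : ∀ x ∈ I₀, ∃ u, ((x = u ∧ x ∉ I) ∨ ∃ p ∈ J, p.1 = u ∧ x ∈ p.2) ∧
    ∀ H : SimpleGraph V, (∀ x y, (x, y) ∈ T → H.Adj x y) →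
      ∃ q : H.Walk u v, a * walkLength pos q + dist (pos x) (pos u) ≤ dist (pos x) (pos v)

theorem walkLength_cons {V : Type*} (pos : V → Plane) {G : SimpleGraph V} {u v w : V}
    (h : G.Adj u v) (p : G.Walk v w) :
    walkLength pos (SimpleGraph.Walk.cons h p) = dist (pos u) (pos v) + walkLength pos p := by
  simp [walkLength]

-- Processing u hands each node waiting at u to the child in its cone. The `reach` bound survives
-- because the new edge cu is paid for by the geometric estimate `hgeo`.
open Classical in
theorem SinkInvariant.step {V : Type*} {pos : V → Plane} (hpos : Function.Injective pos)
    {ID : V → ℕ} {ray : V → ℝ} {k : ℕ} {a : ℝ} (hk : 0 < k) (ha : 0 ≤ a)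
    (hgeo : ∀ (p x y : Plane) (b : ℝ) (j : Fin k), x ∈ cone k p b j → y ∈ cone k p b j →
      dist x p ≤ dist y p → dist y x ≤ dist y p - a * dist x p)
    {v u : V} {I₀ I S : Finset V} {J : List (V × Finset V)} {T : Finset (V × V)}
    (h : SinkInvariant pos ray k a v I₀ I ((u, S) :: J) T) :
    SinkInvariant pos ray k a v I₀
      (I \ ((sinkChildren pos ID ray k u S).map Prod.fst).toFinset)
      (J ++ (sinkChildren pos ID ray k u S).filter fun c => c.1 ∈ I)
      (T ∪ ((sinkChildren pos ID ray k u S).map fun c => (c.1, u)).toFinset) := by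
  set C := sinkChildren pos ID ray k u S with hC
  have hS : ∀ c ∈ C, c.2 ⊆ S := by
    intro c hc x hx
    obtain ⟨j, hj, -, -⟩ := exists_cone_of_mem_sinkChildren hc
    rw [hj] at hx
    exact (mem_conePart.1 hx).1
  have hmem : ∀ c ∈ C, c.1 ∈ c.2 := fun c hc => by
    obtain ⟨j, hj, h, -⟩ := exists_cone_of_mem_sinkChildren hc
    exact h
  have hne : ∀ c ∈ C, ∀ x ∈ c.2, x ≠ u := by
    rintro c hc x hx rfl
    obtain ⟨j, hj, -, -⟩ := exists_cone_of_mem_sinkChildren hc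
    rw [hj] at hx
    exact not_apex_mem_cone _ _ _ _ (mem_conePart.1 hx).2
  -- The set waiting at u may contain u itself, but an apex lies in none of its cones.
  have hI : ∀ c ∈ C, ∀ x ∈ c.2, x ∈ I := fun c hc x hx =>
    (h.waiting _ List.mem_cons_self x (hS c hc hx)).resolve_left (hne c hc x hx)
  have hclose : ∀ c ∈ C, ∀ x ∈ c.2,
      dist (pos x) (pos c.1) ≤ dist (pos x) (pos u) - a * dist (pos c.1) (pos u) := by
    intro c hc x hx
    obtain ⟨j, hj, hc2, hmin⟩ := exists_cone_of_mem_sinkChildren hc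
    have h1 := hmin x hx
    rw [hj] at hx hc2
    exact hgeo _ _ _ _ j (mem_conePart.1 hc2).2 (mem_conePart.1 hx).2 h1
  have hu : ∀ x ∈ S, dist (pos x) (pos u) ≤ dist (pos x) (pos v) := h.closer _ List.mem_cons_self
  -- Children are always still unattached, so the membership test in the loop discards nothing.
  have hfilter : C.filter (fun c => c.1 ∈ I) = C :=
    List.filter_eq_self.2 fun c hc => by simpa using hI c hc _ (hmem c hc)
  rw [hfilter]
  have hmap : ∀ x, x ∈ (C.map Prod.fst).toFinset ↔ ∃ c ∈ C, c.1 = x := by simp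
  have hT : ∀ x y, (x, y) ∈ T ∪ (C.map fun c => (c.1, u)).toFinset ↔
      (x, y) ∈ T ∨ ∃ c ∈ C, c.1 = x ∧ u = y := by
    intro x y
    simp only [Finset.mem_union, List.mem_toFinset, List.mem_map, Prod.mk.injEq]
  have hdisj := List.pairwise_cons.1 h.disjoint
  refine ⟨Finset.sdiff_subset.trans h.subset, ?_, ?_, ?_, ?_, ?_, ?_, ?_, ?_, ?_, ?_, ?_, ?_⟩
  · intro p hp x hx
    rw [Finset.mem_sdiff, hmap]
    rcases List.mem_append.1 hp with hp | hp
    · refine (h.waiting p (List.mem_cons_of_mem _ hp) x hx).imp_right fun hxI => ⟨hxI, ?_⟩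
      rintro ⟨c, hc, rfl⟩
      exact Finset.disjoint_left.1 (hdisj.1 p hp).2 (hS c hc (hmem c hc)) hx
    · by_cases hxp : x = p.1
      · exact Or.inl hxp
      · refine Or.inr ⟨hI p hp x hx, ?_⟩
        rintro ⟨c, hc, rfl⟩
        have hcp : c ≠ p := fun e => hxp (by rw [e])
        have : Std.Symm fun c d : V × Finset V => c.1 ≠ d.1 ∧ Disjoint c.2 d.2 :=
          ⟨fun _ _ h => ⟨h.1.symm, h.2.symm⟩⟩
        exact Finset.disjoint_left.1
          ((pairwise_sinkChildren (ID := ID)).forall hc hp hcp).2 (hmem c hc) hx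
  · intro p hp
    rw [Finset.mem_sdiff, hmap]
    rcases List.mem_append.1 hp with hp | hp
    · exact fun hx => h.attached p (List.mem_cons_of_mem _ hp) hx.1
    · exact fun hx => hx.2 ⟨p, hp, rfl⟩
  · intro p hp
    rcases List.mem_append.1 hp with hp | hp
    · exact h.node p (List.mem_cons_of_mem _ hp)
    · exact Or.inr (h.subset (hI p hp _ (hmem p hp)))
  · intro p hp
    rcases List.mem_append.1 hp with hp | hp
    · exact h.part p (List.mem_cons_of_mem _ hp)
    · exact fun x hx => h.subset (hI p hp x hx)
  · refine List.pairwise_append.2 ⟨hdisj.2, pairwise_sinkChildren, fun p hp c hc => ⟨?_, ?_⟩⟩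
    · intro e
      exact h.attached p (List.mem_cons_of_mem _ hp) (e ▸ hI c hc _ (hmem c hc))
    · exact ((hdisj.1 p hp).2.mono_left (hS c hc)).symm
  · intro p hp x hx
    rcases List.mem_append.1 hp with hp | hp
    · exact h.closer p (List.mem_cons_of_mem _ hp) x hx
    · have h1 := hclose p hp x hx
      have h2 := hu x (hS p hp hx)
      have h3 : 0 ≤ a * dist (pos p.1) (pos u) := mul_nonneg ha dist_nonneg
      linarith
  · intro x y hxy
    rw [Finset.mem_sdiff, hmap]
    rcases (hT x y).1 hxy with hxy | ⟨c, hc, rfl, rfl⟩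
    · exact ⟨(h.source x y hxy).1, fun hx => (h.source x y hxy).2 hx.1⟩
    · exact ⟨h.subset (hI c hc _ (hmem c hc)), fun hx => hx.2 ⟨c, hc, rfl⟩⟩
  · intro x y hxy
    rw [Finset.mem_sdiff]
    rcases (hT x y).1 hxy with hxy | ⟨c, hc, rfl, rfl⟩
    · obtain ⟨h1, h2, h3⟩ := h.target x y hxy
      refine ⟨h1, fun hy => h2 hy.1, fun p hp => ?_⟩
      rcases List.mem_append.1 hp with hp | hp
      · exact h3 p (List.mem_cons_of_mem _ hp)
      · exact fun e => h2 (e ▸ hI p hp _ (hmem p hp))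
    · refine ⟨h.node _ List.mem_cons_self, fun hy => h.attached _ List.mem_cons_self hy.1,
        fun p hp => ?_⟩
      rcases List.mem_append.1 hp with hp | hp
      · exact (hdisj.1 p hp).1.symm
      · exact hne p hp _ (hmem p hp)
  · intro x y hxy
    rcases (hT x y).1 hxy with hxy | ⟨c, hc, rfl, rfl⟩
    · exact h.edge x y hxy
    · exact ⟨hne c hc _ (hmem c hc), hu _ (hS c hc (hmem c hc))⟩
  · intro x y z hy hz
    rcases (hT x y).1 hy with hy | ⟨c, hc, rfl, rfl⟩ <;>
      rcases (hT _ z).1 hz with hz | ⟨d, hd, hdx, rfl⟩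
    · exact h.parent x y z hy hz
    -- A source of an old edge has left I, whereas new children lie in I.
    · exact absurd (hdx ▸ hI d hd _ (hmem d hd)) (h.source x y hy).2
    · exact absurd (hI c hc _ (hmem c hc)) (h.source _ z hz).2
    · rfl
  · intro x y z hx hy j hxj hyj
    rcases (hT x z).1 hx with hx | ⟨c, hc, rfl, rfl⟩ <;>
      rcases (hT y _).1 hy with hy | ⟨d, hd, rfl, he⟩
    · exact h.child x y z hx hy j hxj hyj
    -- A queued node has no children yet, so all edges into u stem from this round.
    · exact absurd he ((h.target x z hx).2.2 _ List.mem_cons_self)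
    · exact absurd rfl ((h.target y _ hy).2.2 _ List.mem_cons_self)
    · exact sinkChildren_unique hc hd hxj hyj
  · intro x hx
    obtain ⟨w, hw, hwalk⟩ := h.reach x hx
    have hmono : ∀ H : SimpleGraph V, (∀ x y, (x, y) ∈ T ∪ (C.map fun c => (c.1, u)).toFinset →
        H.Adj x y) → ∀ x y, (x, y) ∈ T → H.Adj x y :=
      fun H hH x y hxy => hH x y (Finset.mem_union_left _ hxy)
    have hkeep : ∀ {x}, x ∉ I → x ∉ I \ (C.map Prod.fst).toFinset :=
      fun hx h => hx (Finset.mem_sdiff.1 h).1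
    rcases hw with ⟨rfl, hxI⟩ | ⟨p, hp, rfl, hxp⟩
    · exact ⟨x, Or.inl ⟨rfl, hkeep hxI⟩, fun H hH => hwalk H (hmono H hH)⟩
    rcases List.mem_cons.1 hp with rfl | hp
    · by_cases hxu : x = u
      · subst hxu
        exact ⟨x, Or.inl ⟨rfl, hkeep (h.attached _ List.mem_cons_self)⟩,
          fun H hH => hwalk H (hmono H hH)⟩
      · obtain ⟨j, hj⟩ := exists_mem_cone hk (p := pos u) (x := pos x) (ray u)
          (fun e => hxu (hpos e))
        have hxj : x ∈ conePart pos ray k u S j := mem_conePart.2 ⟨hxp, hj⟩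
        obtain ⟨c, hc, hcj⟩ := exists_mem_sinkChildren (ID := ID) hxj
        rw [← hcj] at hxj
        -- x now waits at c: the walk grows by |cu|, while the distance left drops by at least
        -- a|cu|.
        refine ⟨c.1, Or.inr ⟨c, List.mem_append_right _ hc, rfl, hxj⟩, fun H hH => ?_⟩
        obtain ⟨q, hq⟩ := hwalk H (hmono H hH)
        refine ⟨SimpleGraph.Walk.cons (hH _ _ ((hT _ _).2 (Or.inr ⟨c, hc, rfl, rfl⟩))) q, ?_⟩
        rw [walkLength_cons]
        have := hclose c hc x hxj
        simp only at hq
        linarith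
    · exact ⟨p.1, Or.inr ⟨p, List.mem_append_left _ hp, rfl, hxp⟩,
        fun H hH => hwalk H (hmono H hH)⟩

open Classical in
theorem SinkInvariant.sinkLoop {V : Type*} {pos : V → Plane} (hpos : Function.Injective pos)
    {ID : V → ℕ} {ray : V → ℝ} {k : ℕ} {a : ℝ} (hk : 0 < k) (ha : 0 ≤ a)
    (hgeo : ∀ (p x y : Plane) (b : ℝ) (j : Fin k), x ∈ cone k p b j → y ∈ cone k p b j →
      dist x p ≤ dist y p → dist y x ≤ dist y p - a * dist x p)
    {v : V} {I₀ I : Finset V} {J : List (V × Finset V)} {T : Finset (V × V)}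
    (h : SinkInvariant pos ray k a v I₀ I J T) :
    ∃ J', SinkInvariant pos ray k a v I₀ ∅ J' (sinkLoop pos ID ray k I J T) := by
  fun_induction _root_.sinkLoop pos ID ray k I J T with
  | case1 J T => exact ⟨J, h⟩
  -- The queue cannot run dry early: an unattached node always waits at a queued one.
  | case2 I T hI =>
    obtain ⟨x, hx⟩ := Finset.nonempty_iff_ne_empty.2 hI
    obtain ⟨u, hu, -⟩ := h.reach x (h.subset hx)
    rcases hu with hu | ⟨p, hp, -⟩
    · exact absurd hx hu.2
    · simp at hp
  | case3 I T hI u S J ih => exact ih (h.step hpos hk ha hgeo)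

/-! ### Identifiers and the finished sink tree -/

theorem dist_le_of_edgeID_le {V : Type*} {pos : V → Plane} {ID : V → ℕ} {u v w : V}
    (h : edgeID pos ID u v ≤ edgeID pos ID u w) :
    dist (pos u) (pos v) ≤ dist (pos u) (pos w) := by
  rcases min_choice (dirID pos ID u v) (dirID pos ID v u) with h1 | h1 <;>
    rcases min_choice (dirID pos ID u w) (dirID pos ID w u) with h2 | h2 <;>
    rw [edgeID, edgeID, h1, h2] at h <;>
    simpa only [dist_comm (pos v), dist_comm (pos w)] using dist_le_of_dirID_le h

theorem dirID_inj {V : Type*} {pos : V → Plane} {ID : V → ℕ} (hID : Function.Injective ID)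
    {u v x y : V} (h : dirID pos ID u v = dirID pos ID x y) : u = x ∧ v = y := by
  have h1 := congrArg (fun z => (ofLex (ofLex z).2).1) h
  have h2 := congrArg (fun z => (ofLex (ofLex z).2).2) h
  exact ⟨hID h1, hID h2⟩

theorem edgeID_left_inj {V : Type*} {pos : V → Plane} {ID : V → ℕ} (hID : Function.Injective ID)
    {u v w : V} (h : edgeID pos ID u v = edgeID pos ID u w) : v = w := by
  rcases min_choice (dirID pos ID u v) (dirID pos ID v u) with h1 | h1 <;>
    rcases min_choice (dirID pos ID u w) (dirID pos ID w u) with h2 | h2 <;>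
    rw [edgeID, edgeID, h1, h2] at h <;> obtain ⟨h3, h4⟩ := dirID_inj hID h
  · exact h4
  · exact h4.trans h3
  · exact h3.trans h4
  · exact h3

theorem sinkInvariant_init {V : Type*} {pos : V → Plane} {ray : V → ℝ} {k : ℕ} (a : ℝ)
    {v : V} {j : Fin k} {I : Finset V} (hI : ∀ x ∈ I, pos x ∈ cone k (pos v) (ray v) j) :
    SinkInvariant pos ray k a v I I [(v, I)] ∅ where
  subset := subset_rfl
  waiting p hp x hx := by
    obtain rfl := List.mem_singleton.1 hp
    exact Or.inr hx
  attached p hp hx := by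
    obtain rfl := List.mem_singleton.1 hp
    exact not_apex_mem_cone _ _ _ _ (hI _ hx)
  node p hp := by
    obtain rfl := List.mem_singleton.1 hp
    exact Or.inl rfl
  part p hp := by
    obtain rfl := List.mem_singleton.1 hp
    exact subset_rfl
  disjoint := List.pairwise_singleton _ _
  closer p hp x hx := by
    obtain rfl := List.mem_singleton.1 hp
    exact le_rfl
  source _ _ h := by simp at h
  target _ _ h := by simp at h
  edge _ _ h := by simp at h
  parent _ _ _ h := by simp at h
  child _ _ _ h := by simp at h
  reach x hx := ⟨v, Or.inr ⟨_, List.mem_singleton_self _, rfl, hx⟩,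
    fun H _ => ⟨SimpleGraph.Walk.nil, by simp [walkLength]⟩⟩

/-- The properties of the sink tree of `v` and its `j`-th cone that are independent of its
construction. -/
structure IsSinkTree {V : Type*} (pos : V → Plane) (ray : V → ℝ) (k : ℕ) (a : ℝ)
    (E : V → V → Prop) (v : V) (j : Fin k) (T : Finset (V × V)) : Prop where
  source : ∀ x y, (x, y) ∈ T → x ∈ inStar pos ray k E v j
  target : ∀ x y, (x, y) ∈ T → y = v ∨ y ∈ inStar pos ray k E v j
  edge : ∀ x y, (x, y) ∈ T → x ≠ y ∧ dist (pos x) (pos y) ≤ dist (pos x) (pos v)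
  parent : ∀ x y z, (x, y) ∈ T → (x, z) ∈ T → y = z
  child : ∀ x y z, (x, z) ∈ T → (y, z) ∈ T → ∀ i : Fin k, pos x ∈ cone k (pos z) (ray z) i →
    pos y ∈ cone k (pos z) (ray z) i → x = y
  reach : ∀ x ∈ inStar pos ray k E v j, ∀ H : SimpleGraph V, (∀ x y, (x, y) ∈ T → H.Adj x y) →
    ∃ q : H.Walk x v, a * walkLength pos q ≤ dist (pos x) (pos v)

theorem isSinkTree_sinkTree {V : Type*} [Fintype V] {pos : V → Plane}
    (hpos : Function.Injective pos) {ID : V → ℕ} {ray : V → ℝ} {k : ℕ} {a : ℝ} (ha : 0 ≤ a)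
    (hgeo : ∀ (p x y : Plane) (b : ℝ) (j : Fin k), x ∈ cone k p b j → y ∈ cone k p b j →
      dist x p ≤ dist y p → dist y x ≤ dist y p - a * dist x p)
    (E : V → V → Prop) (v : V) (j : Fin k) :
    IsSinkTree pos ray k a E v j (sinkTree pos ID ray k E v j) := by
  classical
  obtain ⟨J, h⟩ := (sinkInvariant_init (pos := pos) (ray := ray) (k := k) a (v := v) (j := j)
    (I := Finset.univ.filter fun u => u ∈ inStar pos ray k E v j) (fun x hx =>
      (Finset.mem_filter.1 hx).2.2)).sinkLoop (ID := ID) hpos j.pos ha hgeo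
  have hmem : ∀ x, x ∈ Finset.univ.filter (fun u => u ∈ inStar pos ray k E v j) ↔
    x ∈ inStar pos ray k E v j := fun x => by simp
  have hT : sinkTree pos ID ray k E v j =
    sinkLoop pos ID ray k (Finset.univ.filter fun u => u ∈ inStar pos ray k E v j)
      [(v, Finset.univ.filter fun u => u ∈ inStar pos ray k E v j)] ∅ := by
    rw [sinkTree]
  rw [← hT] at h
  refine ⟨fun x y hxy => (hmem x).1 (h.source x y hxy).1,
    fun x y hxy => (h.target x y hxy).1.imp_right (hmem y).1, h.edge, h.parent, h.child,
    fun x hx H hH => ?_⟩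
  obtain ⟨u, hu, hwalk⟩ := h.reach x ((hmem x).2 hx)
  -- With I empty, a queued set can contain only its own node, so nothing is left to walk before the
  -- path starts.
  obtain rfl : x = u := by
    rcases hu with hu | ⟨p, hp, rfl, hxp⟩
    · exact hu.1
    · exact (h.waiting p hp x hxp).resolve_right (Finset.notMem_empty x)
  obtain ⟨q, hq⟩ := hwalk H hH
  exact ⟨q, by simpa using hq⟩

/-! ### The Yao and filtering steps -/

theorem yaoStep_unique {V : Type*} {pos : V → Plane} {ID : V → ℕ} (hID : Function.Injective ID)
    {ray : V → ℝ} {k : ℕ} {G : SimpleGraph V} {u v w : V} {j : Fin k}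
    (hv : yaoStep pos ID ray k G u v) (hw : yaoStep pos ID ray k G u w)
    (hvj : pos v ∈ cone k (pos u) (ray u) j) (hwj : pos w ∈ cone k (pos u) (ray u) j) :
    v = w := by
  obtain ⟨i, hi, hi'⟩ := hv
  obtain ⟨l, hl, hl'⟩ := hw
  obtain rfl := cone_disjoint hi.2 hvj
  obtain rfl := cone_disjoint hl.2 hwj
  exact edgeID_left_inj hID (le_antisymm (hi' w hl) (hl' v hi))

theorem exists_yaoStep {V : Type*} [Finite V] {pos : V → Plane} (hpos : Function.Injective pos)
    (ID : V → ℕ) (ray : V → ℝ) {k : ℕ} (hk : 0 < k) {G : SimpleGraph V} {u v : V}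
    (h : G.Adj u v) : ∃ w, yaoStep pos ID ray k G u w ∧
      dist (pos u) (pos w) ≤ dist (pos u) (pos v) ∧
      ∃ j, pos v ∈ cone k (pos u) (ray u) j ∧ pos w ∈ cone k (pos u) (ray u) j := by
  obtain ⟨j, hj⟩ := exists_mem_cone hk (p := pos u) (x := pos v) (ray u)
    (fun e => h.ne (hpos e).symm)
  obtain ⟨w, hw, hmin⟩ := Set.exists_min_image (inCone pos ray k u j (G.neighborSet u))
    (edgeID pos ID u) (Set.toFinite _) ⟨v, h, hj⟩
  exact ⟨w, ⟨j, hw, hmin⟩, dist_le_of_edgeID_le (hmin v ⟨h, hj⟩), j, hj, hw.2⟩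

theorem sparseStep_le {V : Type*} {pos : V → Plane} {ID : V → ℕ} {ray : V → ℝ} {k : ℕ} {r : ℝ}
    {E : V → V → Prop} {u v : V} (h : sparseStep pos ID ray k r E u v) : E u v := by
  obtain ⟨j, u₀, i, -, h⟩ := h
  exact h.1.1.1

/-- The shortest edge of the length class of uv is kept, and lengths within a class differ by a
factor below r. -/
theorem exists_sparseStep {V : Type*} [Finite V] {pos : V → Plane} (hpos : Function.Injective pos)
    (ID : V → ℕ) (ray : V → ℝ) {k : ℕ} (hk : 0 < k) {r : ℝ} (hr : 1 < r) {E : V → V → Prop}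
    {u v : V} (huv : u ≠ v) (h : E u v) : ∃ w, sparseStep pos ID ray k r E w v ∧
      dist (pos w) (pos v) ≤ dist (pos u) (pos v) ∧
      dist (pos u) (pos v) ≤ r * dist (pos w) (pos v) ∧
      ∃ j, pos u ∈ cone k (pos v) (ray v) j ∧ pos w ∈ cone k (pos v) (ray v) j := by
  obtain ⟨j, hj⟩ := exists_mem_cone hk (p := pos v) (x := pos u) (ray v)
    (fun e => huv (hpos e))
  obtain ⟨u₀, h₀, hmin⟩ := Set.exists_min_image (inStar pos ray k E v j)
    (fun w => dirID pos ID w v) (Set.toFinite _) ⟨u, h, hj⟩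
  have hm : 0 < dist (pos u₀) (pos v) := by
    refine dist_pos.2 fun e => ?_
    have := h₀.2
    rw [e] at this
    exact not_apex_mem_cone _ _ _ _ this
  have hle : dist (pos u₀) (pos v) ≤ dist (pos u) (pos v) := dist_le_of_dirID_le (hmin u ⟨h, hj⟩)
  -- The class index: r^i ≤ |uv|/m < r^(i+1), with m the minimum length in the cone.
  obtain ⟨i, hi, hi'⟩ := exists_nat_pow_near ((one_le_div hm).2 hle) hr
  rw [le_div_iff₀' hm] at hi
  rw [div_lt_iff₀' hm] at hi'
  have hu : u ∈ lengthClass pos r (dist (pos u₀) (pos v)) v (inStar pos ray k E v j) i :=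
    ⟨⟨h, hj⟩, hi, hi'⟩
  obtain ⟨w, hw, hwmin⟩ := Set.exists_min_image _ (fun w => dirID pos ID w v) (Set.toFinite _)
    ⟨u, hu⟩
  refine ⟨w, ⟨j, u₀, i, ⟨h₀, hmin⟩, hw, hwmin⟩, dist_le_of_dirID_le (hwmin u hu), ?_,
    j, hj, hw.1.2⟩
  refine hi'.le.trans ?_
  have := mul_le_mul_of_nonneg_left hw.2.1 (zero_le_one.trans hr.le)
  calc _ = r * (dist (pos u₀) (pos v) * r ^ i) := by ring
    _ ≤ _ := this

/-! ### The stretch factor -/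

/-- Converts the published bound on t, with cos 2θ = c² − s², into the inequality the induction
consumes. -/
theorem stretch_inequality {c s r lam t : ℝ} (hc : 0 < c) (hs : 0 ≤ s) (hsc : s ^ 2 + c ^ 2 = 1)
    (hr : 1 < r) (hlam : lam = 1 / (2 * r * c)) (hcond : 1 / (lam + 1) < c - s)
    (ht : lam / (c ^ 2 - s ^ 2) / ((lam + 1) * (c - s) - 1) ≤ t) :
    0 < t ∧ 1 ≤ (c - s) * (t * ((c - s) - r * (1 - (c - s)))) := by
  have hr0 : 0 < r := by linarith
  have hl : 0 < lam := by rw [hlam]; positivity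
  have hl2 : 2 * r * c * lam = 1 := by rw [hlam]; field_simp
  have ha : 0 < c - s := lt_trans (by positivity) hcond
  have hD : 0 < (lam + 1) * (c - s) - 1 := by
    have := (div_lt_iff₀' (by linarith : 0 < lam + 1)).1 hcond
    linarith
  have hq : 0 < c ^ 2 - s ^ 2 := by nlinarith
  have ht0 : 0 < t := lt_of_lt_of_le (by positivity) ht
  refine ⟨ht0, ?_⟩
  have h1 : lam ≤ t * ((lam + 1) * (c - s) - 1) * (c ^ 2 - s ^ 2) := by
    rw [div_le_iff₀ hD] at ht
    exact (div_le_iff₀ hq).1 ht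
  -- Multiplication by 2rc = 1/λ turns (λ+1)(c−s) − 1 into (c−s) − 2cr(1−(c−s)).
  have h2 : 1 ≤ t * ((c - s) - 2 * c * r * (1 - (c - s))) * (c ^ 2 - s ^ 2) := by
    have := mul_le_mul_of_nonneg_left h1 (by positivity : 0 ≤ 2 * r * c)
    rw [hl2] at this
    refine this.trans_eq ?_
    linear_combination t * (c ^ 2 - s ^ 2) * (c - s) * hl2
  have hc1 : c ≤ 1 := by nlinarith
  have hs1 : s ≤ 1 := by nlinarith
  have hcs : 1 ≤ c + s := by nlinarith
  -- A rearrangement of `h7`. The case r = 1 suffices, since the factor of r is nonnegative.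
  have h3 : (c - s) * (c + s - 1) ≤ r * ((1 - (c - s)) * (2 * c * (c + s) - 1)) := by
    have h4 : c - s ≤ 2 * c * (c + s) - 1 := by nlinarith
    have h5 : (c - s) * (c + s - 1) ≤ (1 - (c - s)) * (2 * c * (c + s) - 1) := by
      calc (c - s) * (c + s - 1) ≤ (c - s) * (1 - (c - s)) :=
            mul_le_mul_of_nonneg_left (by linarith) ha.le
        _ ≤ (2 * c * (c + s) - 1) * (1 - (c - s)) :=
            mul_le_mul_of_nonneg_right h4 (by linarith)
        _ = _ := mul_comm _ _
    have h6 : 0 ≤ (1 - (c - s)) * (2 * c * (c + s) - 1) :=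
      le_trans (mul_nonneg ha.le (by linarith)) h5
    nlinarith
  have h7 : (c + s) * ((c - s) - 2 * c * r * (1 - (c - s))) ≤ (c - s) - r * (1 - (c - s)) := by
    linarith
  have h8 := mul_le_mul_of_nonneg_left h7 (mul_nonneg ht0.le ha.le)
  calc (1 : ℝ) ≤ _ := h2
    _ = t * (c - s) * ((c + s) * ((c - s) - 2 * c * r * (1 - (c - s)))) := by ring
    _ ≤ _ := h8
    _ = _ := by ring

theorem walkLength_append {V : Type*} (pos : V → Plane) {G : SimpleGraph V} {u v w : V}
    (p : G.Walk u v) (q : G.Walk v w) :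
    walkLength pos (p.append q) = walkLength pos p + walkLength pos q := by
  simp [walkLength]

/-- Replacing each edge of a walk by its detour bounds the whole walk, so only edges matter. -/
theorem isLengthSpanner_of_edges {V : Type*} {pos : V → Plane} {G H : SimpleGraph V} {t : ℝ}
    (hle : H ≤ G)
    (h : ∀ u v, G.Adj u v → ∃ q : H.Walk u v, walkLength pos q ≤ t * dist (pos u) (pos v)) :
    IsLengthSpanner pos G H t := by
  refine ⟨hle, fun u v p => ?_⟩
  induction p with
  | nil => exact ⟨SimpleGraph.Walk.nil, by simp [walkLength]⟩
  | cons hadj p ih =>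
    obtain ⟨q, hq⟩ := ih
    obtain ⟨q', hq'⟩ := h _ _ hadj
    refine ⟨q'.append q, ?_⟩
    rw [walkLength_append, walkLength_cons, mul_add]
    exact add_le_add hq' hq

theorem exists_spanning_walk {V : Type*} [Finite V] {pos : V → Plane}
    (hpos : Function.Injective pos) {ID : V → ℕ} {ray : V → ℝ} {k : ℕ} (hk : 0 < k)
    {r a t : ℝ} (hr : 1 < r) (ha : 0 < a) (ha1 : a ≤ 1) (ht : 0 < t)
    (hat : 1 ≤ a * (t * (a - r * (1 - a))))
    (hgeo : ∀ (p x y : Plane) (b : ℝ) (j : Fin k), x ∈ cone k p b j → y ∈ cone k p b j →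
      dist x p ≤ dist y p → dist y x ≤ dist y p - a * dist x p)
    {H : SimpleGraph V}
    (hsink : ∀ x v, sparseStep pos ID ray k r (yaoStep pos ID ray k (unitDiskGraph pos)) x v →
      ∃ q : H.Walk x v, a * walkLength pos q ≤ dist (pos x) (pos v))
    (u v : V) (huv : dist (pos u) (pos v) ≤ 1) :
    ∃ q : H.Walk u v, walkLength pos q ≤ t * dist (pos u) (pos v) := by
  -- Finitely many pairs make induction on real lengths legitimate.
  have hwf : WellFounded fun e f : V × V =>
      dist (pos e.1) (pos e.2) < dist (pos f.1) (pos f.2) := by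
    have : IsTrans (V × V) fun e f => dist (pos e.1) (pos e.2) < dist (pos f.1) (pos f.2) :=
      ⟨fun _ _ _ => lt_trans⟩
    have : Std.Irrefl fun e f : V × V => dist (pos e.1) (pos e.2) < dist (pos f.1) (pos f.2) :=
      ⟨fun _ => lt_irrefl _⟩
    exact Finite.wellFounded_of_trans_of_irrefl _
  suffices ∀ e : V × V, dist (pos e.1) (pos e.2) ≤ 1 →
      ∃ q : H.Walk e.1 e.2, walkLength pos q ≤ t * dist (pos e.1) (pos e.2) from this (u, v) huv
  intro e
  induction e using hwf.induction with
  | _ e ih =>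
  obtain ⟨u, v⟩ := e
  simp only at ih ⊢
  intro huv
  by_cases hne : u = v
  · subst hne
    exact ⟨SimpleGraph.Walk.nil, by simp [walkLength]⟩
  obtain ⟨w, hw, hwv, j, hvj, hwj⟩ := exists_yaoStep hpos ID ray hk
    (G := unitDiskGraph pos) (u := u) (v := v) ⟨hne, huv⟩
  have huw : u ≠ w := by
    rintro rfl
    exact not_apex_mem_cone _ _ _ _ hwj
  obtain ⟨x, hx, hxw, hxr, i, hui, hxi⟩ := exists_sparseStep hpos ID ray hk hr huw hw
  have hxpos : 0 < dist (pos x) (pos w) := by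
    refine dist_pos.2 fun e => ?_
    rw [e] at hxi
    exact not_apex_mem_cone _ _ _ _ hxi
  have hwpos : 0 < dist (pos u) (pos w) := hxpos.trans_le hxw
  have g1 := hgeo _ _ _ _ i hxi hui hxw
  have g2 := hgeo _ _ _ _ j hwj hvj (by rwa [dist_comm (pos w), dist_comm (pos v)])
  rw [dist_comm (pos v), dist_comm (pos v) (pos u), dist_comm (pos w) (pos u)] at g2
  have p1 := mul_pos ha hxpos
  have p2 := mul_pos ha hwpos
  -- Both pairs are strictly shorter than uv, because |xw| and |uw| are positive. The case u = x is
  -- harmless: equal ends are covered by the empty walk.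
  obtain ⟨q1, hq1⟩ := ih (u, x) (show dist (pos u) (pos x) < _ by linarith)
    (show dist (pos u) (pos x) ≤ _ by linarith)
  obtain ⟨q3, hq3⟩ := ih (w, v) (show dist (pos w) (pos v) < _ by linarith)
    (show dist (pos w) (pos v) ≤ _ by linarith)
  obtain ⟨q2, hq2⟩ := hsink x w hx
  refine ⟨(q1.append q2).append q3, ?_⟩
  rw [walkLength_append, walkLength_append]
  simp only at q1 hq1 q3 hq3
  have h1 := mul_le_mul_of_nonneg_left g1 ht.le
  have h2 := mul_le_mul_of_nonneg_left g2 ht.le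
  -- The tree path costs at most |xw|/a, which `hat` charges to the savings of the two inductive
  -- paths.
  have h3 : walkLength pos q2 ≤ t * (a - r * (1 - a)) * dist (pos x) (pos w) := by
    refine le_of_mul_le_mul_left (hq2.trans ?_) ha
    have := mul_le_mul_of_nonneg_right hat hxpos.le
    linarith
  have h4 : t * ((1 - a) * dist (pos u) (pos w)) ≤ t * ((1 - a) * (r * dist (pos x) (pos w))) :=
    mul_le_mul_of_nonneg_left (mul_le_mul_of_nonneg_left hxr (by linarith)) ht.le
  linarith

/-! ### The degree bound -/

theorem ncard_neighborSet_le {V : Type*} [Fintype V] {pos : V → Plane}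
    (hpos : Function.Injective pos) {ID : V → ℕ} (hID : Function.Injective ID) {ray : V → ℝ}
    {k : ℕ} (hk : 0 < k) {G : SimpleGraph V} {a : ℝ} {E : V → V → Prop}
    (hE : ∀ u v, E u v → yaoStep pos ID ray k G u v)
    (htree : ∀ v j, IsSinkTree pos ray k a E v j (sinkTree pos ID ray k E v j)) (x : V) :
    ((SimpleGraph.fromRel (sinkStep pos ID ray k E)).neighborSet x).ncard ≤ k * (k + 2) := by
  classical
  -- One slot per possible neighbour: `inl j` is the child of x in its own j-th tree. `inr (i, l)`
  -- concerns the tree whose root lies in cone i of x, with `none` for the parent and `some l` for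
  -- the child in cone l.
  let R : Fin k ⊕ Fin k × Option (Fin k) → V → Prop
    | .inl j, y => (y, x) ∈ sinkTree pos ID ray k E x j
    | .inr (i, l), y => ∃ v j, x ∈ inStar pos ray k E v j ∧ pos v ∈ cone k (pos x) (ray x) i ∧
        match l with
        | none => (x, y) ∈ sinkTree pos ID ray k E v j
        | some l => (y, x) ∈ sinkTree pos ID ray k E v j ∧ pos y ∈ cone k (pos x) (ray x) l
  have hcone : ∀ {u v}, u ≠ v → ∃ j : Fin k, pos v ∈ cone k (pos u) (ray u) j := fun h =>
    exists_mem_cone hk _ fun e => h (hpos e).symm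
  have hne : ∀ {v j}, x ∈ inStar pos ray k E v j → x ≠ v := by
    rintro v j hx rfl
    exact not_apex_mem_cone _ _ _ _ hx.2
  have huniq : ∀ c y z, R c y → R c z → y = z := by
    rintro (j | ⟨i, l⟩) y z hy hz
    -- All nodes of this tree lie in cone j of x, so the root has a single child.
    · exact (htree x j).child y z x hy hz j ((htree x j).source _ _ hy).2
        ((htree x j).source _ _ hz).2
    · obtain ⟨v, j, hx, hv, hy⟩ := hy
      obtain ⟨v', j', hx', hv', hz⟩ := hz
      -- The Yao edge out of x in cone i fixes the root, and the position of x fixes the cone of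
      -- that root.
      obtain rfl := yaoStep_unique hID (hE _ _ hx.1) (hE _ _ hx'.1) hv hv'
      obtain rfl := cone_disjoint hx.2 hx'.2
      rcases l with _ | l
      · exact (htree v j).parent x y z hy hz
      · exact (htree v j).child y z x hy.1 hz.1 l hy.2 hz.2
  have hex : ∀ y ∈ (SimpleGraph.fromRel (sinkStep pos ID ray k E)).neighborSet x, ∃ c, R c y := by
    rintro y ⟨hxy, ⟨v, j, h⟩ | ⟨v, j, h⟩⟩
    · have hx := (htree v j).source _ _ h
      obtain ⟨i, hi⟩ := hcone (hne hx)
      exact ⟨.inr (i, none), v, j, hx, hi, h⟩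
    · rcases (htree v j).target _ _ h with rfl | hx
      · exact ⟨.inl j, h⟩
      · obtain ⟨i, hi⟩ := hcone (hne hx)
        obtain ⟨l, hl⟩ := hcone hxy
        exact ⟨.inr (i, some l), v, j, hx, hi, h, hl⟩
  have : Nonempty (Fin k) := ⟨⟨0, hk⟩⟩
  choose! f hf using hex
  have hinj : Set.InjOn f ((SimpleGraph.fromRel (sinkStep pos ID ray k E)).neighborSet x) :=
    fun y hy z hz e => huniq (f y) y z (hf y hy) (e ▸ hf z hz)
  calc _ = (f '' _).ncard := hinj.ncard_image.symm
    _ ≤ Nat.card (Fin k ⊕ Fin k × Option (Fin k)) := Set.ncard_le_card _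
    _ = k * (k + 2) := by
      simp only [Nat.card_eq_fintype_card, Fintype.card_sum, Fintype.card_prod, Fintype.card_fin,
        Fintype.card_option]
      ring

/-! ### Assembly -/

theorem theorem2 {V : Type*} [Fintype V] (pos : V → Plane) (hpos : Function.Injective pos)
    (ID : V → ℕ) (hID : Function.Injective ID) (ray : V → ℝ)
    (k : ℕ) (hk : 8 ≤ k) (r θ lam : ℝ) (hr : 1 < r) (hθ : θ = 2 * Real.pi / k)
    (hlam : lam = 1 / (2 * r * Real.cos θ))
    (hcond : 1 / (lam + 1) < Real.cos θ - Real.sin θ) :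
    (∀ v : V, ((yaoSparseSink pos ID ray k r (unitDiskGraph pos)).neighborSet v).ncard
        ≤ k * (k + 2)) ∧
      ∀ t : ℝ,
        (lam / Real.cos (2 * θ)) / ((lam + 1) * (Real.cos θ - Real.sin θ) - 1) ≤ t →
        IsLengthSpanner pos (unitDiskGraph pos)
          (yaoSparseSink pos ID ray k r (unitDiskGraph pos)) t := by
  have hk0 : 0 < k := by omega
  have hk8 : (8 : ℝ) ≤ k := by exact_mod_cast hk
  have hπ := Real.pi_pos
  have hθ0 : 0 < θ := by rw [hθ]; positivity
  have hθ4 : θ ≤ Real.pi / 4 := by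
    rw [hθ, div_le_iff₀ (by linarith)]
    nlinarith
  have hc : 0 < Real.cos θ := Real.cos_pos_of_mem_Ioo ⟨by linarith, by linarith⟩
  have hs : 0 ≤ Real.sin θ := Real.sin_nonneg_of_nonneg_of_le_pi hθ0.le (by linarith)
  have hlam0 : 0 < lam := by rw [hlam]; positivity
  have ha : 0 < Real.cos θ - Real.sin θ := lt_trans (by positivity) hcond
  have ha1 : Real.cos θ - Real.sin θ ≤ 1 := by linarith [Real.cos_le_one θ]
  have hgeo : ∀ (p x y : Plane) (b : ℝ) (j : Fin k), x ∈ cone k p b j → y ∈ cone k p b j →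
      dist x p ≤ dist y p → dist y x ≤ dist y p - (Real.cos θ - Real.sin θ) * dist x p :=
    fun p x y b j hx hy h => dist_le_of_mem_cone hθ (by linarith) hs hx hy h
  have htree := isSinkTree_sinkTree (ID := ID) (ray := ray) hpos ha.le hgeo
    (sparseStep pos ID ray k r (yaoStep pos ID ray k (unitDiskGraph pos)))
  refine ⟨ncard_neighborSet_le hpos hID hk0 (fun u v => sparseStep_le) htree, fun t ht => ?_⟩
  rw [Real.cos_two_mul'] at ht
  obtain ⟨ht0, hat⟩ := stretch_inequality hc hs (Real.sin_sq_add_cos_sq θ) hr hlam hcond ht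
  have hadj : ∀ x y, sinkStep pos ID ray k
      (sparseStep pos ID ray k r (yaoStep pos ID ray k (unitDiskGraph pos))) x y →
      (unitDiskGraph pos).Adj x y := by
    rintro x y ⟨v, j, h⟩
    obtain ⟨h1, h2⟩ := (htree v j).edge x y h
    obtain ⟨i, hi, -⟩ := sparseStep_le ((htree v j).source x y h).1
    -- A tree edge is no longer than the Yao edge from its source to the root, hence at most 1.
    exact ⟨h1, h2.trans hi.1.2⟩
  refine isLengthSpanner_of_edges ?_ fun u v huv => exists_spanning_walk (ID := ID) (ray := ray)
    hpos hk0 hr ha ha1 ht0 hat hgeo (fun x v hx => ?_) u v huv.2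
  · rintro x y ⟨-, h | h⟩
    · exact hadj x y h
    · exact (hadj y x h).symm
  · obtain ⟨j, hj⟩ := exists_mem_cone hk0 (p := pos v) (x := pos x) (ray v) (by
      obtain ⟨i, hi, -⟩ := sparseStep_le hx
      exact fun e => hi.1.1 (hpos e))
    refine (htree v j).reach x ⟨hx, hj⟩ _ fun x y hxy => ?_
    exact ⟨((htree v j).edge x y hxy).1, Or.inl ⟨v, j, hxy⟩⟩
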